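/- Let $G$ be a discrete group. A compact Hausdorff $G$-space is a non-empty compact Hausdorff space on which $G$ acts by homeomorphisms; $P(X)$ denotes the set of regular Borel probability measures on such a space $X$, with the weak* topology and the action $(s\nu)(Y)=\nu(s^{-1}Y)$. A $G$-boundary is a compact Hausdorff $G$-space $X$ such that every orbit $Gx$, $x\in X$, is dense in $X$, and such that for every $\nu\in P(X)$ the weak* closure of the orbit $G\nu$ contains a point mass. The Furstenberg boundary $\partial_F G$ is the universal $G$-boundary, i.e. the $G$-boundary (unique up to equivariant homeomorphism) of which every $G$-boundary is a continuous $G$-equivariant image. Let $G$ act on the algebra $C(\partial_F G)$ of continuous complex functions by $(sf)(x)=f(s^{-1}x)$ and on $\ell^\infty(G)$ by $(s\varphi)(t)=\varphi(s^{-1}t)$. For $\nu\in P(\partial_F G)$ the Poisson map $P_\nu\colon C(\partial_F G)\to\ell^\infty(G)$ is $$P_\nu(f)(s)=\int_{\partial_F G} f(sx)\,d\nu(x),\qquad s\in G .$$ An isometric $G$-equivariant copy of $C(\partial_F G)$ in $\ell^\infty(G)$ is the image $\psi(C(\partial_F G))$ of an isometric $G$-equivariant linear map $\psi\colon C(\partial_F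 G)\to\ell^\infty(G)$. Then the map $\nu\mapsto P_\nu(C(\partial_F G))$ is a bijection from $P(\partial_F G)$ onto the collection of isometric $G$-equivariant copies of $C(\partial_F G)$ in $\ell^\infty(G)$. Moreover, for $\nu\in P(\partial_F G)$, the image $P_\nu(C(\partial_F G))$ is a C*-subalgebra of $\ell^\infty(G)$ if and only if $\nu$ is a point mass. -/

import Mathlib

open MeasureTheory Set Topology
open scoped ENNReal

universe u v

noncomputable section

namespace FurstenbergCopies

section Measures

variable (G : Type u) [Group G] (X : Type v) [TopologicalSpace X] [MeasurableSpace X]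
  [BorelSpace X] [MulAction G X] [ContinuousConstSMul G X]

/-- The set `P(X)` of regular Borel probability measures on `X`. Its weak* topology is the one
that Mathlib puts on `ProbabilityMeasure X` (convergence of integrals of bounded continuous
functions). -/
def regularProb (X : Type v) [TopologicalSpace X] [MeasurableSpace X] :
    Set (ProbabilityMeasure X) :=
  {ν | (ν : Measure X).Regular}

variable {G X} in
/-- The action of `G` on measures: `(s ν)(Y) = ν(s⁻¹ Y)`, the push-forward under `x ↦ s x`. -/
def translateMeasure (s : G) (ν : ProbabilityMeasure X) : ProbabilityMeasure X :=
  ν.map (f := fun x : X => s • x) (continuous_const_smul s).measurable.aemeasurable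

/-- The action is minimal: every orbit is dense. -/
def IsMinimalAction (G : Type u) [Group G] (X : Type v) [TopologicalSpace X] [MulAction G X] :
    Prop :=
  ∀ x : X, Dense (MulAction.orbit G x)

/-- The action is strongly proximal: for every `ν ∈ P(X)` the weak* closure of the orbit `G ν`
contains a point mass. -/
def IsStronglyProximal : Prop :=
  ∀ ν ∈ regularProb X, ∃ x : X,
    diracProba x ∈ closure (Set.range fun s : G => translateMeasure s ν)

/-- A `G`-boundary: a non-empty compact Hausdorff `G`-space whose action is minimal and strongly
proximal. -/
structure IsBoundary : Prop where
  nonempty : Nonempty X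
  compactSpace : CompactSpace X
  t2Space : T2Space X
  minimal : IsMinimalAction G X
  stronglyProximal : IsStronglyProximal G X

/-- `X` is the Furstenberg boundary of `G`: it is a `G`-boundary, and it is universal in the sense
that every `G`-boundary is a continuous `G`-equivariant image of it. As every `G`-boundary is a
quotient of the Stone-Cech compactification of `G`, it is no restriction to let `B` range over the
universe of `G`. -/
structure IsFurstenbergBoundary : Prop where
  isBoundary : IsBoundary G X
  universal : ∀ (B : Type u) [TopologicalSpace B] [MeasurableSpace B] [BorelSpace B]
    [MulAction G B] [ContinuousConstSMul G B], IsBoundary G B →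
      ∃ p : X → B, Continuous p ∧ Function.Surjective p ∧ ∀ (s : G) (x : X), p (s • x) = s • p x

end Measures

/-- The C*-algebra `ℓ^∞(G)` of bounded complex functions on `G`, with the supremum norm and
pointwise operations. -/
abbrev LInf (G : Type u) : Type u := lp (fun _ : G => ℂ) ∞

/-- The action of `G` on `C(X)`: `(s f)(x) = f(s⁻¹ x)`. -/
def translateC {G : Type u} [Group G] {X : Type v} [TopologicalSpace X] [MulAction G X]
    [ContinuousConstSMul G X] (s : G) (f : C(X, ℂ)) : C(X, ℂ) :=
  ⟨fun x => f (s⁻¹ • x), f.continuous.comp (continuous_const_smul s⁻¹)⟩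

/-- The action of `G` on `ℓ^∞(G)`: `(s φ)(t) = φ(s⁻¹ t)`. -/
def translateLInf {G : Type u} [Group G] (s : G) (φ : LInf G) : LInf G :=
  ⟨fun t => φ (s⁻¹ * t), by
    apply memℓp_infty
    refine ⟨‖φ‖, ?_⟩
    rintro _ ⟨t, rfl⟩
    exact lp.norm_apply_le_norm ENNReal.top_ne_zero φ (s⁻¹ * t)⟩

section Poisson

variable {G : Type u} [Group G] {X : Type v} [TopologicalSpace X] [CompactSpace X]
  [MeasurableSpace X] [MulAction G X]

/-- The Poisson map `P_ν : C(X) → ℓ^∞(G)`, `P_ν(f)(s) = ∫ f(s x) dν(x)`. -/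
def poissonMap (ν : ProbabilityMeasure X) (f : C(X, ℂ)) : LInf G :=
  ⟨fun s => ∫ x, f (s • x) ∂(ν : Measure X), by
    apply memℓp_infty
    refine ⟨‖f‖, ?_⟩
    rintro _ ⟨s, rfl⟩
    simpa using norm_integral_le_of_norm_le_const (μ := (ν : Measure X)) (C := ‖f‖)
      (Filter.Eventually.of_forall fun x => f.norm_coe_le_norm (s • x))⟩

/-- `S` is an isometric `G`-equivariant copy of `C(X)` in `ℓ^∞(G)`: the image of `C(X)` under
an isometric `G`-equivariant linear map. -/
def IsEquivariantCopy [ContinuousConstSMul G X] (S : Set (LInf G)) : Prop :=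
  ∃ ψ : C(X, ℂ) →ₗᵢ[ℂ] LInf G,
    (∀ (s : G) (f : C(X, ℂ)), ψ (translateC s f) = translateLInf s (ψ f)) ∧ Set.range ψ = S

end Poisson

/-- `S` is a C*-subalgebra of `ℓ^∞(G)`: a norm-closed `*`-subalgebra. -/
def IsCStarSubalgebra {G : Type u} (S : Set (LInf G)) : Prop :=
  ∃ A : NonUnitalStarSubalgebra ℂ (LInf G), IsClosed (A : Set (LInf G)) ∧ (A : Set (LInf G)) = S

end FurstenbergCopies

end

/-!
Strong proximality and minimality put every point mass `δ_x` in the closure of every orbit `G ν`;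
applied to the midpoint of `μ` and `ν` this gives one filter on `G` along which both `s μ` and
`s ν` tend to `δ_x`, so that `P_μ(f)(s) → f(x)` and `P_ν(f)(s) → f(x)`.
Hence `f` is recovered from `P_ν(f)` without knowing `ν`: Poisson maps are isometric, equality of
two ranges forces `P_μ = P_ν`, and a range closed under multiplication forces
`P_ν(f g) = P_ν(f) P_ν(g)`, so that `ν` is a character of `C(X)`.
Conversely, an isometric equivariant `ψ` sends `1` to a constant function `c` with `|c| = 1`, and
`f ↦ c⁻¹ ψ(f)(e)` is a state on `C(X)`, that is, integration against some `ν`; equivariance then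
gives `ψ = c P_ν`.
-/

namespace FurstenbergCopies

open Filter
open scoped CompactlySupported NNReal BoundedContinuousFunction

section States

variable {X : Type v} [TopologicalSpace X]

lemma ext_realToRCLike {E : Type*} [AddCommGroup E] [Module ℂ E] {Λ Λ' : C(X, ℂ) →ₗ[ℂ] E}
    (h : ∀ f : C(X, ℝ), Λ (f.realToRCLike ℂ) = Λ' (f.realToRCLike ℂ)) : Λ = Λ' := by
  ext f
  let re : C(X, ℝ) := ⟨fun x => (f x).re, by fun_prop⟩
  let im : C(X, ℝ) := ⟨fun x => (f x).im, by fun_prop⟩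
  have hf : f = re.realToRCLike ℂ + Complex.I • im.realToRCLike ℂ := by
    ext x
    simp [re, im, mul_comm Complex.I]
  rw [hf, map_add, map_add, map_smul, map_smul, h, h]

variable [CompactSpace X]

/-- The disc of centre `t` and radius `√(‖f‖² + t²)` contains the values of `f`, hence `Λ f`; as
`t → ∞` these discs exhaust the right half-plane. -/
lemma re_nonneg_of_contractive {Λ : C(X, ℂ) →ₗ[ℂ] ℂ} (hΛ : ∀ f, ‖Λ f‖ ≤ ‖f‖) (hone : Λ 1 = 1)
    {f : C(X, ℂ)} (hf : ∀ x, 0 ≤ (f x).re) : 0 ≤ (Λ f).re := by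
  have norm_sub_sq (z : ℂ) (t : ℝ) : ‖z - t‖ ^ 2 = ‖z‖ ^ 2 - 2 * t * z.re + t ^ 2 := by
    simp only [← Complex.normSq_eq_norm_sq, Complex.normSq_apply, Complex.sub_re, Complex.sub_im,
      Complex.ofReal_re, Complex.ofReal_im]
    ring
  have hdisc (t : ℝ) (ht : 0 ≤ t) : ‖Λ f - t‖ ^ 2 ≤ ‖f‖ ^ 2 + t ^ 2 := by
    have hle : ‖f - (t : ℂ) • 1‖ ≤ √(‖f‖ ^ 2 + t ^ 2) := by
      refine (ContinuousMap.norm_le _ (Real.sqrt_nonneg _)).2 fun x => Real.le_sqrt_of_sq_le ?_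
      have hfx : ‖f x‖ ^ 2 ≤ ‖f‖ ^ 2 := by gcongr; exact f.norm_coe_le_norm x
      have htx : 0 ≤ t * (f x).re := mul_nonneg ht (hf x)
      simp only [ContinuousMap.sub_apply, ContinuousMap.smul_apply, ContinuousMap.one_apply,
        smul_eq_mul, mul_one, norm_sub_sq]
      linarith
    have hsub : Λ f - t = Λ (f - (t : ℂ) • 1) := by simp [hone]
    rw [hsub]
    exact (Real.le_sqrt (norm_nonneg _) (by positivity)).1 ((hΛ _).trans hle)
  have hbound (t : ℝ) (ht : 0 ≤ t) : -(2 * (Λ f).re) * t ≤ ‖f‖ ^ 2 := by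
    have h := hdisc t ht
    rw [norm_sub_sq] at h
    linarith [sq_nonneg ‖Λ f‖]
  by_contra! hneg
  have hpos : 0 < -(2 * (Λ f).re) := by linarith
  have h := hbound ((‖f‖ ^ 2 + 1) / -(2 * (Λ f).re)) (by positivity)
  rw [mul_div_cancel₀ _ hpos.ne'] at h
  linarith

lemma im_eq_zero_of_contractive {Λ : C(X, ℂ) →ₗ[ℂ] ℂ} (hΛ : ∀ f, ‖Λ f‖ ≤ ‖f‖) (hone : Λ 1 = 1)
    (f : C(X, ℝ)) : (Λ (f.realToRCLike ℂ)).im = 0 := by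
  have hle := re_nonneg_of_contractive hΛ hone (f := Complex.I • f.realToRCLike ℂ) (by simp)
  have hge := re_nonneg_of_contractive hΛ hone (f := -Complex.I • f.realToRCLike ℂ) (by simp)
  rw [map_smul] at hle hge
  simp only [smul_eq_mul, neg_mul, Complex.neg_re, Complex.I_mul_re, neg_neg] at hle hge
  linarith

variable [MeasurableSpace X] [BorelSpace X]

/-- The functional `f ↦ ∫ f dμ` on `C(X)`. -/
noncomputable def integralLinearMap (μ : Measure X) [IsFiniteMeasure μ] : C(X, ℂ) →ₗ[ℂ] ℂ where
  toFun f := ∫ x, f x ∂μ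
  map_add' f g := integral_add
    ((map_continuous f).integrable_of_hasCompactSupport (.of_compactSpace _))
    ((map_continuous g).integrable_of_hasCompactSupport (.of_compactSpace _))
  map_smul' c f := integral_const_mul c f

variable [T2Space X]

lemma regularProb_ext {μ ν : ProbabilityMeasure X} (hμ : μ ∈ regularProb X)
    (hν : ν ∈ regularProb X)
    (h : ∀ f : C(X, ℂ), ∫ x, f x ∂(μ : Measure X) = ∫ x, f x ∂(ν : Measure X)) : μ = ν := by
  have : (μ : Measure X).Regular := hμ
  have : (ν : Measure X).Regular := hν
  have heq : (μ : Measure X) = (ν : Measure X) :=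
    Measure.ext_of_integral_eq_on_compactlySupported fun f => Complex.ofReal_injective <|
      integral_complex_ofReal.symm.trans <|
        (h (f.toContinuousMap.realToRCLike ℂ)).trans integral_complex_ofReal
  exact Subtype.ext heq

lemma exists_regularProb_of_positive (M : C(X, ℝ) →ₗ[ℝ] ℝ) (hpos : ∀ f, 0 ≤ f → 0 ≤ M f)
    (hone : M 1 = 1) : ∃ ν ∈ regularProb X, ∀ f, ∫ x, f x ∂(ν : Measure X) = M f := by
  let M' : C_c(X, ℝ) →ₗ[ℝ] ℝ :=
    { toFun f := M f.toContinuousMap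
      map_add' f g := map_add M f.toContinuousMap g.toContinuousMap
      map_smul' c f := map_smul M c f.toContinuousMap }
  let P : C_c(X, ℝ) →ₚ[ℝ] ℝ := PositiveLinearMap.mk₀ M' fun f hf => hpos _ fun x => hf x
  have hP (f : C(X, ℝ)) : ∫ x, f x ∂(RealRMK.rieszMeasure P) = M f :=
    RealRMK.integral_rieszMeasure P ⟨f, .of_compactSpace _⟩
  have hprob : IsProbabilityMeasure (RealRMK.rieszMeasure P) := by
    have h := (hP 1).trans hone
    exact ⟨by simpa [Measure.real, ENNReal.toReal_eq_one_iff] using h⟩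
  exact ⟨⟨RealRMK.rieszMeasure P, hprob⟩, RealRMK.regular_rieszMeasure P, hP⟩

lemma exists_regularProb_of_contractive {Λ : C(X, ℂ) →ₗ[ℂ] ℂ} (hΛ : ∀ f, ‖Λ f‖ ≤ ‖f‖)
    (hone : Λ 1 = 1) : ∃ ν ∈ regularProb X, ∀ f, Λ f = ∫ x, f x ∂(ν : Measure X) := by
  let M : C(X, ℝ) →ₗ[ℝ] ℝ := Complex.reLm ∘ₗ Λ.restrictScalars ℝ ∘ₗ
    (ContinuousMap.realToRCLikeStarAlgHom X ℂ).toAlgHom.toLinearMap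
  have hM (f : C(X, ℝ)) : M f = (Λ (f.realToRCLike ℂ)).re := rfl
  have hMone : M 1 = 1 := by
    have h : (1 : C(X, ℝ)).realToRCLike ℂ = 1 := map_one (ContinuousMap.realToRCLikeStarAlgHom X ℂ)
    rw [hM, h, hone, Complex.one_re]
  obtain ⟨ν, hν, hint⟩ := exists_regularProb_of_positive M
    (fun f hf => re_nonneg_of_contractive hΛ hone fun x => by simpa using hf x)
    hMone
  have hreal (f : C(X, ℝ)) :
      Λ (f.realToRCLike ℂ) = integralLinearMap (ν : Measure X) (f.realToRCLike ℂ) :=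
    calc Λ (f.realToRCLike ℂ) = (M f : ℂ) :=
          Complex.ext (by simp [hM]) (by simp [im_eq_zero_of_contractive hΛ hone])
      _ = ((∫ x, f x ∂(ν : Measure X) : ℝ) : ℂ) := by rw [hint]
      _ = ∫ x, (f x : ℂ) ∂(ν : Measure X) := integral_complex_ofReal.symm
  exact ⟨ν, hν, fun f => LinearMap.congr_fun (ext_realToRCLike hreal) f⟩

end States

section PointMasses

variable {X : Type v} [TopologicalSpace X] [MeasurableSpace X]

/-- If `μ i ≤ c • ν i`, then `|∫ f dμ i - f x| ≤ c ∫ |f - f x| dν i`. -/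
lemma tendsto_diracProba_of_le_smul [OpensMeasurableSpace X] {ι : Type*} {l : Filter ι}
    {μ ν : ι → ProbabilityMeasure X} {c : ℝ≥0} {x : X}
    (hle : ∀ i, (μ i : Measure X) ≤ c • (ν i : Measure X))
    (hν : Tendsto ν l (𝓝 (diracProba x))) : Tendsto μ l (𝓝 (diracProba x)) := by
  rw [ProbabilityMeasure.tendsto_iff_forall_integral_tendsto] at hν ⊢
  intro f
  let d : X →ᵇ ℝ := BoundedContinuousFunction.ofNormedAddCommGroup (fun y => ‖f y - f x‖)
    (by fun_prop) (2 * ‖f‖) fun y => by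
      simpa [dist_eq_norm] using f.dist_le_two_norm y x
  have hdirac (g : X →ᵇ ℝ) : ∫ y, g y ∂(diracProba x : Measure X) = g x :=
    integral_dirac' _ _ g.continuous.stronglyMeasurable
  have hd : Tendsto (fun i => (c : ℝ) * ∫ y, d y ∂(ν i : Measure X)) l (𝓝 0) := by
    have hdx : d x = 0 := by simp [d]
    simpa only [hdirac, hdx, mul_zero] using (hν d).const_mul (c : ℝ)
  rw [hdirac, tendsto_iff_norm_sub_tendsto_zero]
  refine squeeze_zero (fun _ => norm_nonneg _) (fun i => ?_) hd
  calc ‖∫ y, f y ∂(μ i : Measure X) - f x‖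
      = ‖∫ y, (f y - f x) ∂(μ i : Measure X)‖ := by
        rw [integral_sub (f.integrable _) (integrable_const _)]
        simp
    _ ≤ ∫ y, d y ∂(μ i : Measure X) := norm_integral_le_integral_norm _
    _ ≤ ∫ y, d y ∂(c • (ν i : Measure X)) :=
        integral_mono_measure (hle i) (.of_forall fun y => norm_nonneg (f y - f x))
          (d.integrable _)
    _ = c * ∫ y, d y ∂(ν i : Measure X) := integral_smul_nnreal_measure _ _

variable [BorelSpace X]

lemma diracProba_mem_regularProb [R1Space X] (x : X) : diracProba x ∈ regularProb X := by
  have : (Measure.dirac x).InnerRegular := by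
    refine ⟨fun s hs r hr => ?_⟩
    have hx : x ∈ s := by
      by_contra hx
      simp [Measure.dirac_apply' _ hs, hx] at hr
    exact ⟨{x}, by simpa using hx, isCompact_singleton, by
      simpa [Measure.dirac_apply' _ hs, hx] using hr⟩
  exact inferInstanceAs (Measure.dirac x).Regular

lemma exists_regularProb_le_two_smul [R1Space X] {μ ν : ProbabilityMeasure X}
    (hμ : μ ∈ regularProb X) (hν : ν ∈ regularProb X) :
    ∃ ρ ∈ regularProb X, (μ : Measure X) ≤ (2 : ℝ≥0) • (ρ : Measure X) ∧
      (ν : Measure X) ≤ (2 : ℝ≥0) • (ρ : Measure X) := by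
  have : (μ : Measure X).Regular := hμ
  have : (ν : Measure X).Regular := hν
  let m : Measure X := (2⁻¹ : ℝ≥0) • ((μ : Measure X) + (ν : Measure X))
  have hm : IsProbabilityMeasure m := ⟨by
    simp [m, ENNReal.smul_def, ENNReal.inv_two_add_inv_two]⟩
  have hdouble : (2 : ℝ≥0) • m = (μ : Measure X) + (ν : Measure X) := by
    simp [m, smul_smul]
  have hreg : ((μ : Measure X) + (ν : Measure X)).Regular := inferInstance
  refine ⟨⟨m, hm⟩, Measure.Regular.smul_nnreal _, ?_, ?_⟩
  · exact (Measure.le_add_right le_rfl).trans_eq hdouble.symm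
  · exact (Measure.le_add_left le_rfl).trans_eq hdouble.symm

lemma exists_eq_diracProba_of_integral_mul [CompactSpace X] [T2Space X]
    {ν : ProbabilityMeasure X} (hν : ν ∈ regularProb X)
    (hmul : ∀ f g : C(X, ℂ), ∫ x, (f * g) x ∂(ν : Measure X) =
      (∫ x, f x ∂(ν : Measure X)) * ∫ x, g x ∂(ν : Measure X)) :
    ∃ x : X, ν = diracProba x := by
  let φ : C(X, ℂ) →ₐ[ℂ] ℂ :=
    AlgHom.ofLinearMap (integralLinearMap (ν : Measure X)) (by simp [integralLinearMap]) hmul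
  obtain ⟨x, hx⟩ := (WeakDual.CharacterSpace.continuousMapEval_bijective X ℂ).2
    (WeakDual.CharacterSpace.equivAlgHom.symm φ)
  refine ⟨x, regularProb_ext hν (diracProba_mem_regularProb x) fun f => ?_⟩
  calc ∫ y, f y ∂(ν : Measure X) = f x := (DFunLike.congr_fun hx f).symm
    _ = ∫ y, f y ∂(diracProba x : Measure X) :=
      (integral_dirac' _ _ (map_continuous f).stronglyMeasurable).symm

end PointMasses

section TranslateMeasure

variable {G : Type u} [Group G] {X : Type v} [TopologicalSpace X] [MeasurableSpace X]
  [BorelSpace X] [MulAction G X] [ContinuousConstSMul G X]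

lemma translateMeasure_mul (s t : G) (ν : ProbabilityMeasure X) :
    translateMeasure (s * t) ν = translateMeasure s (translateMeasure t ν) := by
  refine Subtype.ext ?_
  change (ν : Measure X).map ((s * t) • ·) = ((ν : Measure X).map (t • ·)).map (s • ·)
  rw [Measure.map_map (continuous_const_smul s).measurable (continuous_const_smul t).measurable]
  simp only [Function.comp_def, mul_smul]

lemma translateMeasure_diracProba (s : G) (x : X) :
    translateMeasure s (diracProba x) = diracProba (s • x) :=
  Subtype.ext (Measure.map_dirac' (continuous_const_smul s).measurable x)

lemma translateMeasure_le_smul {μ ν : ProbabilityMeasure X} {c : ℝ≥0}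
    (h : (μ : Measure X) ≤ c • (ν : Measure X)) (s : G) :
    (translateMeasure s μ : Measure X) ≤ c • (translateMeasure s ν : Measure X) := by
  change (μ : Measure X).map (s • ·) ≤ c • (ν : Measure X).map (s • ·)
  rw [← Measure.map_smul]
  exact Measure.map_mono h (continuous_const_smul s).measurable

lemma IsBoundary.diracProba_mem_closure (hX : IsBoundary G X) {ν : ProbabilityMeasure X}
    (hν : ν ∈ regularProb X) (x : X) :
    diracProba x ∈ closure (range fun s : G => translateMeasure s ν) := by
  obtain ⟨x₀, hx₀⟩ := hX.stronglyProximal ν hν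
  have horbit : MulAction.orbit G x₀ ⊆
      diracProba ⁻¹' closure (range fun s : G => translateMeasure s ν) := by
    rintro _ ⟨t, rfl⟩
    have hmaps : MapsTo (translateMeasure t) (range fun s : G => translateMeasure s ν)
        (range fun s : G => translateMeasure s ν) := by
      rintro _ ⟨s, rfl⟩
      exact ⟨t * s, translateMeasure_mul t s ν⟩
    have ht : translateMeasure t (diracProba x₀) ∈
        closure (range fun s : G => translateMeasure s ν) := map_mem_closure
      (ProbabilityMeasure.continuous_map (continuous_const_smul t)) hx₀ hmaps
    rwa [translateMeasure_diracProba] at ht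
  exact closure_minimal horbit (isClosed_closure.preimage continuous_diracProba) (hX.minimal x₀ x)

lemma IsBoundary.exists_tendsto_translateMeasure (hX : IsBoundary G X)
    {μ ν : ProbabilityMeasure X} (hμ : μ ∈ regularProb X) (hν : ν ∈ regularProb X) (x : X) :
    ∃ l : Filter G, l.NeBot ∧
      Tendsto (fun s => translateMeasure s μ) l (𝓝 (diracProba x)) ∧
      Tendsto (fun s => translateMeasure s ν) l (𝓝 (diracProba x)) := by
  have := hX.t2Space
  obtain ⟨ρ, hρ, hμρ, hνρ⟩ := exists_regularProb_le_two_smul hμ hν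
  let l : Filter G := comap (fun s => translateMeasure s ρ) (𝓝 (diracProba x))
  have hl : Tendsto (fun s => translateMeasure s ρ) l (𝓝 (diracProba x)) := tendsto_comap
  refine ⟨l, ?_, tendsto_diracProba_of_le_smul (translateMeasure_le_smul hμρ) hl,
    tendsto_diracProba_of_le_smul (translateMeasure_le_smul hνρ) hl⟩
  refine comap_neBot fun U hU => ?_
  obtain ⟨_, hsU, s, rfl⟩ := mem_closure_iff_nhds.1 (hX.diracProba_mem_closure hρ x) U hU
  exact ⟨s, hsU⟩

end TranslateMeasure

section Equivariant

variable {G : Type u} [Group G] {X : Type v} [TopologicalSpace X] [MulAction G X]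
  [ContinuousConstSMul G X]

/-- `ψ : C(X) → ℓ^∞(G)` is `G`-equivariant. -/
def IsEquivariant (ψ : C(X, ℂ) → LInf G) : Prop :=
  ∀ (s : G) (f : C(X, ℂ)), ψ (translateC s f) = translateLInf s (ψ f)

lemma IsEquivariant.apply_eq {ψ : C(X, ℂ) → LInf G} (hψ : IsEquivariant ψ) (f : C(X, ℂ))
    (s : G) : ψ f s = ψ (translateC s⁻¹ f) 1 := by
  rw [hψ]
  change ψ f s = ψ f (s⁻¹⁻¹ * 1)
  rw [inv_inv, mul_one]

lemma IsEquivariant.map_one_eq_smul {ψ : C(X, ℂ) → LInf G} (hψ : IsEquivariant ψ) :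
    ψ 1 = ψ 1 1 • (1 : LInf G) := by
  ext s
  have hone : translateC s⁻¹ (1 : C(X, ℂ)) = 1 := rfl
  rw [hψ.apply_eq, hone, lp.coeFn_smul, lp.infty_coeFn_one, Pi.smul_apply, Pi.one_apply,
    smul_eq_mul, mul_one]

end Equivariant

section Poisson

variable {G : Type u} [Group G] {X : Type v} [TopologicalSpace X] [CompactSpace X]
  [MeasurableSpace X] [MulAction G X]

lemma poissonMap_apply (ν : ProbabilityMeasure X) (f : C(X, ℂ)) (s : G) :
    poissonMap ν f s = ∫ x, f (s • x) ∂(ν : Measure X) := rfl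

lemma poissonMap_one_apply (ν : ProbabilityMeasure X) (f : C(X, ℂ)) :
    poissonMap ν f (1 : G) = ∫ x, f x ∂(ν : Measure X) := by
  simp only [poissonMap_apply, one_smul]

lemma norm_poissonMap_le (ν : ProbabilityMeasure X) (f : C(X, ℂ)) :
    ‖(poissonMap ν f : LInf G)‖ ≤ ‖f‖ := by
  refine lp.norm_le_of_forall_le (norm_nonneg _) fun s => ?_
  simpa [poissonMap_apply] using norm_integral_le_of_norm_le_const (μ := (ν : Measure X))
    (C := ‖f‖) (.of_forall fun x => f.norm_coe_le_norm (s • x))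

variable [ContinuousConstSMul G X]

lemma isEquivariant_poissonMap (ν : ProbabilityMeasure X) :
    IsEquivariant (poissonMap ν : C(X, ℂ) → LInf G) := by
  intro s f
  ext t
  change ∫ x, f (s⁻¹ • t • x) ∂(ν : Measure X) = ∫ x, f ((s⁻¹ * t) • x) ∂(ν : Measure X)
  simp only [mul_smul]

variable [BorelSpace X]

lemma poissonMap_diracProba_apply (x : X) (f : C(X, ℂ)) (s : G) :
    poissonMap (diracProba x) f s = f (s • x) :=
  integral_dirac' _ _ ((map_continuous f).comp (continuous_const_smul s)).stronglyMeasurable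

lemma poissonMap_apply_eq_integral_translateMeasure (ν : ProbabilityMeasure X) (f : C(X, ℂ))
    (s : G) : poissonMap ν f s = ∫ x, f x ∂(translateMeasure s ν : Measure X) :=
  (integral_map (continuous_const_smul s).measurable.aemeasurable
    (map_continuous f).aestronglyMeasurable).symm

/-- The Poisson map as a linear map. -/
noncomputable def poissonLinearMap (ν : ProbabilityMeasure X) : C(X, ℂ) →ₗ[ℂ] LInf G where
  toFun := poissonMap ν
  map_add' f g := by
    ext s
    simp only [poissonMap_apply_eq_integral_translateMeasure, lp.coeFn_add, Pi.add_apply]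
    exact map_add (integralLinearMap _) f g
  map_smul' c f := by
    ext s
    exact integral_const_mul c _

lemma tendsto_poissonMap {l : Filter G} {ν : ProbabilityMeasure X} {x : X}
    (h : Tendsto (fun s => translateMeasure s ν) l (𝓝 (diracProba x))) (f : C(X, ℂ)) :
    Tendsto (poissonMap ν f) l (𝓝 (f x)) := by
  have hf := (ProbabilityMeasure.tendsto_iff_forall_integral_rclike_tendsto ℂ).1 h
    (BoundedContinuousFunction.mkOfCompact f)
  have hx : ∫ y, f y ∂(diracProba x : Measure X) = f x :=
    integral_dirac' _ _ (map_continuous f).stronglyMeasurable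
  simpa only [BoundedContinuousFunction.mkOfCompact_apply, hx,
    ← poissonMap_apply_eq_integral_translateMeasure] using hf

lemma exists_eq_poissonMap_of_contractive [T2Space X] {ψ : C(X, ℂ) →ₗ[ℂ] LInf G}
    (hψ : IsEquivariant ψ) (hnorm : ∀ f, ‖ψ f‖ ≤ ‖f‖) (hone : ψ 1 = 1) :
    ∃ ν ∈ regularProb X, ∀ f, ψ f = poissonMap ν f := by
  let Λ : C(X, ℂ) →ₗ[ℂ] ℂ :=
    { toFun f := ψ f 1
      map_add' f g := by rw [map_add]; rfl
      map_smul' c f := by rw [map_smul]; rfl }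
  have hΛone : Λ 1 = 1 := by
    change ψ 1 1 = 1
    rw [hone, lp.infty_coeFn_one, Pi.one_apply]
  obtain ⟨ν, hν, hint⟩ := exists_regularProb_of_contractive (Λ := Λ)
    (fun f => (lp.norm_apply_le_norm ENNReal.top_ne_zero (ψ f) 1).trans (hnorm f)) hΛone
  refine ⟨ν, hν, fun f => ?_⟩
  ext s
  calc ψ f s = Λ (translateC s⁻¹ f) := hψ.apply_eq f s
    _ = poissonMap ν (translateC s⁻¹ f) (1 : G) := by rw [hint, poissonMap_one_apply]
    _ = poissonMap ν f s := ((isEquivariant_poissonMap ν).apply_eq f s).symm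

lemma exists_eq_smul_poissonMap [T2Space X] [Nonempty X] {ψ : C(X, ℂ) →ₗᵢ[ℂ] LInf G}
    (hψ : IsEquivariant ψ) :
    ∃ ν ∈ regularProb X, ∃ c : ℂ, c ≠ 0 ∧ ∀ f, ψ f = c • poissonMap ν f := by
  obtain ⟨c, hc⟩ : ∃ c : ℂ, ψ 1 = c • (1 : LInf G) := ⟨_, hψ.map_one_eq_smul⟩
  have hcnorm : ‖c‖ = 1 := by
    have h := ψ.norm_map 1
    rwa [hc, norm_smul, norm_one, norm_one, mul_one] at h
  have hc₀ : c ≠ 0 := norm_ne_zero_iff.1 (hcnorm ▸ one_ne_zero)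
  obtain ⟨ν, hν, hP⟩ := exists_eq_poissonMap_of_contractive (ψ := c⁻¹ • ψ.toLinearMap)
    (fun s f => by
      change c⁻¹ • ψ (translateC s f) = translateLInf s (c⁻¹ • ψ f)
      rw [hψ]
      rfl)
    (fun f => by simp [norm_smul, hcnorm])
    (by
      change c⁻¹ • ψ 1 = 1
      rw [hc, inv_smul_smul₀ hc₀])
  exact ⟨ν, hν, c, hc₀, fun f => (inv_smul_eq_iff₀ hc₀).1 (hP f)⟩

lemma exists_range_poissonMap_eq [T2Space X] [Nonempty X] {ψ : C(X, ℂ) →ₗᵢ[ℂ] LInf G}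
    (hψ : IsEquivariant ψ) :
    ∃ ν ∈ regularProb X, range (poissonMap ν : C(X, ℂ) → LInf G) = range ψ := by
  obtain ⟨ν, hν, c, hc, hP⟩ := exists_eq_smul_poissonMap hψ
  refine ⟨ν, hν, Subset.antisymm ?_ ?_⟩
  · rintro _ ⟨f, rfl⟩
    exact ⟨c⁻¹ • f, by rw [map_smul, hP, inv_smul_smul₀ hc]⟩
  · rintro _ ⟨f, rfl⟩
    exact ⟨c • f, (map_smul (poissonLinearMap ν) c f).trans (hP f).symm⟩

/-- The Poisson map of a point mass `δ_x` is `f ↦ (s ↦ f (s x))`, a `*`-homomorphism. -/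
noncomputable def poissonStarAlgHom (x : X) : C(X, ℂ) →⋆ₙₐ[ℂ] LInf G where
  toFun := poissonMap (diracProba x)
  map_smul' := map_smul (poissonLinearMap (diracProba x))
  map_zero' := map_zero (poissonLinearMap (diracProba x))
  map_add' := map_add (poissonLinearMap (diracProba x))
  map_mul' f g := by
    ext s
    simp only [poissonMap_diracProba_apply, lp.infty_coeFn_mul, Pi.mul_apply,
      ContinuousMap.mul_apply]
  map_star' f := by
    ext s
    simp only [poissonMap_diracProba_apply, lp.star_apply, ContinuousMap.star_apply]

end Poisson

namespace IsBoundary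

variable {G : Type u} [Group G] {X : Type v} [TopologicalSpace X] [CompactSpace X]
  [MeasurableSpace X] [BorelSpace X] [MulAction G X] [ContinuousConstSMul G X]
  {μ ν : ProbabilityMeasure X}

lemma exists_tendsto_poissonMap (hX : IsBoundary G X) (hμ : μ ∈ regularProb X)
    (hν : ν ∈ regularProb X) (x : X) :
    ∃ l : Filter G, l.NeBot ∧ (∀ f, Tendsto (poissonMap μ f) l (𝓝 (f x))) ∧
      ∀ f, Tendsto (poissonMap ν f) l (𝓝 (f x)) := by
  obtain ⟨l, hl, hlμ, hlν⟩ := hX.exists_tendsto_translateMeasure hμ hν x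
  exact ⟨l, hl, tendsto_poissonMap hlμ, tendsto_poissonMap hlν⟩

lemma norm_poissonMap (hX : IsBoundary G X) (hν : ν ∈ regularProb X) (f : C(X, ℂ)) :
    ‖(poissonMap ν f : LInf G)‖ = ‖f‖ := by
  refine le_antisymm (norm_poissonMap_le ν f)
    ((ContinuousMap.norm_le _ (norm_nonneg _)).2 fun x => ?_)
  obtain ⟨l, _, hl, -⟩ := hX.exists_tendsto_poissonMap hν hν x
  exact le_of_tendsto (hl f).norm
    (.of_forall fun s => lp.norm_apply_le_norm ENNReal.top_ne_zero (poissonMap ν f) s)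

/-- The Poisson map of a regular probability measure on a boundary, as a linear isometry. -/
noncomputable def poissonIsometry (hX : IsBoundary G X) (hν : ν ∈ regularProb X) :
    C(X, ℂ) →ₗᵢ[ℂ] LInf G where
  toLinearMap := poissonLinearMap ν
  norm_map' := hX.norm_poissonMap hν

lemma eq_of_poissonMap_eq (hX : IsBoundary G X) (hμ : μ ∈ regularProb X)
    (hν : ν ∈ regularProb X) {f g : C(X, ℂ)}
    (h : (poissonMap μ f : LInf G) = poissonMap ν g) : f = g := by
  ext x
  obtain ⟨l, _, hlμ, hlν⟩ := hX.exists_tendsto_poissonMap hμ hν x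
  exact tendsto_nhds_unique (h ▸ hlμ f) (hlν g)

lemma injOn_range_poissonMap (hX : IsBoundary G X) :
    InjOn (fun ν : ProbabilityMeasure X => range (poissonMap ν : C(X, ℂ) → LInf G))
      (regularProb X) := by
  have := hX.t2Space
  intro μ hμ ν hν hμν
  refine regularProb_ext hμ hν fun f => ?_
  obtain ⟨g, hg⟩ : (poissonMap μ f : LInf G) ∈ range (poissonMap ν : C(X, ℂ) → LInf G) :=
    hμν.subset ⟨f, rfl⟩
  obtain rfl := hX.eq_of_poissonMap_eq hν hμ hg
  rw [← poissonMap_one_apply (G := G), ← poissonMap_one_apply (G := G), hg]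

lemma bijOn_range_poissonMap (hX : IsBoundary G X) :
    BijOn (fun ν : ProbabilityMeasure X => range (poissonMap ν : C(X, ℂ) → LInf G))
      (regularProb X) {S : Set (LInf G) | IsEquivariantCopy (G := G) (X := X) S} := by
  have := hX.t2Space
  have := hX.nonempty
  refine ⟨fun ν hν => ?_, hX.injOn_range_poissonMap, ?_⟩
  · exact ⟨hX.poissonIsometry hν, isEquivariant_poissonMap ν, rfl⟩
  · rintro _ ⟨ψ, hψ, rfl⟩
    exact exists_range_poissonMap_eq hψ

lemma poissonMap_mul_of_isCStarSubalgebra (hX : IsBoundary G X) (hν : ν ∈ regularProb X)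
    (hA : IsCStarSubalgebra (range (poissonMap ν : C(X, ℂ) → LInf G))) (f g : C(X, ℂ)) :
    (poissonMap ν (f * g) : LInf G) = poissonMap ν f * poissonMap ν g := by
  obtain ⟨A, -, hA⟩ := hA
  have hmem (k : C(X, ℂ)) : (poissonMap ν k : LInf G) ∈ A := hA.superset ⟨k, rfl⟩
  obtain ⟨h, hh⟩ := hA.subset (A.mul_mem (hmem f) (hmem g))
  have hfg : h = f * g := by
    ext x
    obtain ⟨l, _, hl, -⟩ := hX.exists_tendsto_poissonMap hν hν x
    have hlim : Tendsto (poissonMap ν h) l (𝓝 (f x * g x)) := by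
      rw [hh, lp.infty_coeFn_mul]
      exact (hl f).mul (hl g)
    exact tendsto_nhds_unique (hl h) hlim
  rw [← hfg, hh]

lemma isCStarSubalgebra_range_poissonMap_iff (hX : IsBoundary G X) (hν : ν ∈ regularProb X) :
    IsCStarSubalgebra (range (poissonMap ν : C(X, ℂ) → LInf G)) ↔ ∃ x, ν = diracProba x := by
  have := hX.t2Space
  constructor
  · refine fun hA => exists_eq_diracProba_of_integral_mul hν fun f g => ?_
    simp only [← poissonMap_one_apply (G := G), hX.poissonMap_mul_of_isCStarSubalgebra hν hA,
      lp.infty_coeFn_mul, Pi.mul_apply]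
  · rintro ⟨x, rfl⟩
    exact ⟨NonUnitalStarAlgHom.range (poissonStarAlgHom x),
      (hX.poissonIsometry hν).isometry.isClosedEmbedding.isClosed_range, rfl⟩

end IsBoundary

end FurstenbergCopies

open FurstenbergCopies in
theorem mainTheorem11_general {G : Type u} [Group G] {X : Type v} [TopologicalSpace X]
    [CompactSpace X] [MeasurableSpace X] [BorelSpace X] [MulAction G X] [ContinuousConstSMul G X]
    (hX : IsBoundary G X) :
    Set.BijOn
        (fun ν : ProbabilityMeasure X => Set.range (poissonMap ν : C(X, ℂ) → LInf G))
        (regularProb X) {S : Set (LInf G) | IsEquivariantCopy (G := G) (X := X) S} ∧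
      ∀ ν ∈ regularProb X,
        IsCStarSubalgebra (Set.range (poissonMap ν : C(X, ℂ) → LInf G)) ↔
          ∃ x : X, ν = diracProba x :=
  ⟨hX.bijOn_range_poissonMap, fun _ hν => hX.isCStarSubalgebra_range_poissonMap_iff hν⟩

theorem mainTheorem11 (G : Type u) [Group G] (X : Type v) [TopologicalSpace X] [CompactSpace X]
    [T2Space X] [MeasurableSpace X] [BorelSpace X] [MulAction G X] [ContinuousConstSMul G X]
    (hX : FurstenbergCopies.IsFurstenbergBoundary G X) :
    Set.BijOn
        (fun ν : ProbabilityMeasure X =>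
          Set.range (FurstenbergCopies.poissonMap ν : C(X, ℂ) → FurstenbergCopies.LInf G))
        (FurstenbergCopies.regularProb X)
        {S : Set (FurstenbergCopies.LInf G) |
          FurstenbergCopies.IsEquivariantCopy (G := G) (X := X) S} ∧
      ∀ ν ∈ FurstenbergCopies.regularProb X,
        FurstenbergCopies.IsCStarSubalgebra
            (Set.range (FurstenbergCopies.poissonMap ν : C(X, ℂ) → FurstenbergCopies.LInf G)) ↔
          ∃ x : X, ν = diracProba x :=
  mainTheorem11_general hX.isBoundary
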